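/- Let $N\ge 1$ be an integer and let $a$ be real with $\frac1{N+1}<a<1$. Let $b$ be defined by $(N+1)a-Nb=1$. Put $x_i=\frac{i}{2N+1}$ for $0\le i\le 2N+1$, and $y_{2j}=j(a-b)$, $y_{2j+1}=(j+1)a-jb$ for $0\le j\le N$. Let $f_0(x)=x$ on $[0,1]$ and, for $n\ge1$, $$f_n(x)=y_i+(y_{i+1}-y_i)\,f_{n-1}\big((2N+1)(x-x_i)\big),\qquad x_i\le x\le x_{i+1},\quad i=0,1,\dots,2N,$$ and let $F_{N,a}:[0,1]\to\mathbb R$ be the uniform limit of $(f_n)$. Put $a_0^*=\frac{3N+1}{(N+1)(2N+1)}$ and let $\tilde a_0$ be the unique root in $\left(\frac1{N+1},1\right)$ of the equation $(2N+1)^{2N+1}t^{N+1}\big((N+1)t-1\big)^N=N^N$ in $t$. "Differentiable at $x$" means having a finite derivative at $x$ (one-sided at $x=0$ and $x=1$), and "almost everywhere" refers to Lebesgue measure on $[0,1]$. Then: (i) If $a_0^*\le a<1$, then $F_{N,a}$ is differentiable at no point of $[0,1]$. (ii) If $\tilde a_0\le a<a_0^*$, then $F_{N,a}$ is nondifferentiable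 almost everywhere, but is differentiable at uncountably many points of $(0,1)$. (iii) If $\frac1{N+1}<a<\tilde a_0$, then $F_{N,a}$ is differentiable almost everywhere, but is nondifferentiable at uncountably many points of $(0,1)$. Moreover, for every $a$ with $\frac1{N+1}<a<1$, if $F_{N,a}$ is differentiable at a point $x\in(0,1)$, then $F_{N,a}'(x)=0$. -/

import Mathlib

open Filter Topology Set MeasureTheory

namespace OkamotoAllaart

/-- The number `b` determined by `(N + 1) a - N b = 1`. -/
noncomputable def bParam (N : ℕ) (a : ℝ) : ℝ := (((N : ℝ) + 1) * a - 1) / (N : ℝ)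

/-- The abscissae `x_i = i / (2N + 1)`. -/
noncomputable def nodeX (N i : ℕ) : ℝ := (i : ℝ) / (2 * (N : ℝ) + 1)

/-- The ordinates `y_{2j} = j (a - b)` and `y_{2j+1} = (j + 1) a - j b`. -/
noncomputable def nodeY (N : ℕ) (a : ℝ) (i : ℕ) : ℝ :=
  if Even i then ((i / 2 : ℕ) : ℝ) * (a - bParam N a)
  else (((i / 2 : ℕ) : ℝ) + 1) * a - ((i / 2 : ℕ) : ℝ) * bParam N a

/-- The piecewise linear approximants: `f_0 (x) = x`, and
`f_{n+1} (x) = y_i + (y_{i+1} - y_i) f_n ((2N + 1) (x - x_i))` for `x_i ≤ x ≤ x_{i+1}`.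
The index `i` is chosen as `min ⌊(2N + 1) x⌋ (2N)`; see `approx_succ_of_mem` for the recursion on
each closed interval `[x_i, x_{i+1}]`. Only the values on `[0, 1]` are meaningful. -/
noncomputable def approx (N : ℕ) (a : ℝ) : ℕ → ℝ → ℝ
  | 0, x => x
  | n + 1, x =>
    let i : ℕ := min ⌊(2 * (N : ℝ) + 1) * x⌋₊ (2 * N)
    nodeY N a i + (nodeY N a (i + 1) - nodeY N a i) *
      approx N a n ((2 * (N : ℝ) + 1) * (x - nodeX N i))

/-- The function `F_{N,a}`, the limit of the approximants on `[0, 1]`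
(the convergence is uniform there, see `tendstoUniformlyOn_F`). -/
noncomputable def F (N : ℕ) (a : ℝ) (x : ℝ) : ℝ := limUnder atTop (fun n => approx N a n x)

/-- The lower end `1 / (N + 1)` of the range of parameters. -/
noncomputable def aMin (N : ℕ) : ℝ := 1 / ((N : ℝ) + 1)

/-- The threshold `a₀^* = (3N + 1) / ((N + 1) (2N + 1))`. -/
noncomputable def aStar (N : ℕ) : ℝ :=
  (3 * (N : ℝ) + 1) / (((N : ℝ) + 1) * (2 * (N : ℝ) + 1))

/-- `t` lies in `(1 / (N + 1), 1)` and `(2N+1)^{2N+1} t^{N+1} ((N+1) t - 1)^N = N^N`. -/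
def IsThreshold (N : ℕ) (t : ℝ) : Prop :=
  t ∈ Ioo (aMin N) 1 ∧
    (2 * (N : ℝ) + 1) ^ (2 * N + 1) * t ^ (N + 1) * (((N : ℝ) + 1) * t - 1) ^ N = (N : ℝ) ^ N

/-- The threshold `ã₀`: the root described by `IsThreshold`, which exists and is unique
for `N ≥ 1` (see `existsUnique_isThreshold` and `isThreshold_aTilde`). -/
noncomputable def aTilde (N : ℕ) : ℝ := sInf {t : ℝ | IsThreshold N t}

theorem existsUnique_isThreshold {N : ℕ} (hN : 1 ≤ N) : ∃! t : ℝ, IsThreshold N t := by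
  have hN0 : (1 : ℝ) ≤ N := by exact_mod_cast hN
  have hp : (0 : ℝ) < (N : ℝ) + 1 := by positivity
  have hmin : 0 < aMin N := by unfold aMin; positivity
  have hmin1 : aMin N < 1 := by
    unfold aMin; rw [div_lt_one hp]; linarith
  have hmul : ((N : ℝ) + 1) * aMin N = 1 := by unfold aMin; field_simp
  set g : ℝ → ℝ := fun t =>
    (2 * (N : ℝ) + 1) ^ (2 * N + 1) * t ^ (N + 1) * (((N : ℝ) + 1) * t - 1) ^ N with hg
  have hmono : ∀ s t : ℝ, aMin N < s → s < t → g s < g t := by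
    intro s t hs hst
    have h1 : 0 < ((N : ℝ) + 1) * s - 1 := by nlinarith
    have h2 : ((N : ℝ) + 1) * s - 1 < ((N : ℝ) + 1) * t - 1 := by nlinarith
    have hs0 : 0 < s := hmin.trans hs
    have h3 : s ^ (N + 1) < t ^ (N + 1) := pow_lt_pow_left₀ hst hs0.le (by omega)
    have h4 : (((N : ℝ) + 1) * s - 1) ^ N < (((N : ℝ) + 1) * t - 1) ^ N :=
      pow_lt_pow_left₀ h2 h1.le (by omega)
    have ht0 : 0 < t := hs0.trans hst
    simp only [hg]
    gcongr
  have hcont : ContinuousOn g (Icc (aMin N) 1) := by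
    apply Continuous.continuousOn; simp only [hg]; fun_prop
  have hlow : g (aMin N) = 0 := by
    simp only [hg, hmul, sub_self]
    rw [zero_pow (by omega), mul_zero]
  have hhigh : (N : ℝ) ^ N < g 1 := by
    have h1 : (1 : ℝ) < (2 * (N : ℝ) + 1) ^ (2 * N + 1) := one_lt_pow₀ (by linarith) (by omega)
    have h2 : (0 : ℝ) < (N : ℝ) ^ N := by positivity
    have h3 : g 1 = (2 * (N : ℝ) + 1) ^ (2 * N + 1) * (N : ℝ) ^ N := by
      simp only [hg]; ring_nf
    rw [h3]; nlinarith
  have hpos : g (aMin N) < (N : ℝ) ^ N := by rw [hlow]; positivity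
  obtain ⟨t, ht, hgt⟩ := intermediate_value_Ioo hmin1.le hcont ⟨hpos, hhigh⟩
  refine ⟨t, ⟨ht, hgt⟩, ?_⟩
  rintro s ⟨hs, hgs⟩
  have hgs' : g s = g t := by rw [hgt]; exact hgs
  rcases lt_trichotomy s t with h | h | h
  · exact absurd hgs' (hmono s t hs.1 h).ne
  · exact h
  · exact absurd hgs' (hmono t s ht.1 h).ne'

theorem isThreshold_aTilde {N : ℕ} (hN : 1 ≤ N) : IsThreshold N (aTilde N) := by
  obtain ⟨t, ht, huniq⟩ := existsUnique_isThreshold hN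
  have : {t : ℝ | IsThreshold N t} = {t} := by
    ext s; exact ⟨fun h => huniq s h, fun h => by rw [mem_singleton_iff] at h; rw [h]; exact ht⟩
  unfold aTilde
  rw [this, csInf_singleton]
  exact ht

theorem bParam_spec {N : ℕ} (hN : 1 ≤ N) (a : ℝ) :
    ((N : ℝ) + 1) * a - (N : ℝ) * bParam N a = 1 := by
  have hN0 : (N : ℝ) ≠ 0 := by positivity
  unfold bParam
  field_simp
  ring

theorem nodeY_even (N : ℕ) (a : ℝ) (j : ℕ) :
    nodeY N a (2 * j) = (j : ℝ) * (a - bParam N a) := by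
  simp [nodeY]

theorem nodeY_odd (N : ℕ) (a : ℝ) (j : ℕ) :
    nodeY N a (2 * j + 1) = ((j : ℝ) + 1) * a - (j : ℝ) * bParam N a := by
  have h : ¬ Even (2 * j + 1) := by simp
  have h2 : (2 * j + 1) / 2 = j := by omega
  simp [nodeY, h2]

theorem nodeY_slope (N : ℕ) (a : ℝ) (i : ℕ) :
    nodeY N a (i + 1) - nodeY N a i = if Even i then a else - bParam N a := by
  obtain ⟨j, rfl | rfl⟩ := Nat.even_or_odd' i
  · rw [nodeY_odd, nodeY_even]; simp; ring
  · rw [nodeY_odd, show 2 * j + 1 + 1 = 2 * (j + 1) by ring, nodeY_even]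
    have h : ¬ Even (2 * j + 1) := by simp
    rw [if_neg h]; push_cast; ring

theorem approx_left (N : ℕ) (a : ℝ) (n : ℕ) : approx N a n 0 = 0 := by
  induction n with
  | zero => rfl
  | succ n ih => simp [approx, nodeX, nodeY, ih]

theorem approx_right {N : ℕ} (hN : 1 ≤ N) (a : ℝ) (n : ℕ) : approx N a n 1 = 1 := by
  induction n with
  | zero => rfl
  | succ n ih =>
    have h1 : ⌊(2 * (N : ℝ) + 1) * 1⌋₊ = 2 * N + 1 := by
      rw [mul_one]; exact_mod_cast Nat.floor_natCast (R := ℝ) (2 * N + 1)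
    have h2 : min (2 * N + 1) (2 * N) = 2 * N := by omega
    have h3 : (2 * (N : ℝ) + 1) * (1 - nodeX N (2 * N)) = 1 := by
      unfold nodeX; push_cast; field_simp; ring
    simp only [approx, h1, h2, h3, ih]
    rw [mul_one, add_sub_cancel, nodeY_odd, bParam_spec hN]

/-- The recursion on each closed interval `[x_i, x_{i+1}]`. -/
theorem approx_succ_of_mem {N : ℕ} (hN : 1 ≤ N) (a : ℝ) (n : ℕ) {i : ℕ} (hi : i ≤ 2 * N) {x : ℝ}
    (hx : x ∈ Icc (nodeX N i) (nodeX N (i + 1))) :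
    approx N a (n + 1) x = nodeY N a i + (nodeY N a (i + 1) - nodeY N a i) *
      approx N a n ((2 * (N : ℝ) + 1) * (x - nodeX N i)) := by
  have hq : (0 : ℝ) < 2 * (N : ℝ) + 1 := by positivity
  obtain ⟨h1, h2⟩ := hx
  rcases h2.lt_or_eq with h2 | h2
  · have hfl : ⌊(2 * (N : ℝ) + 1) * x⌋₊ = i := by
      unfold nodeX at h1 h2
      rw [div_le_iff₀ hq] at h1
      rw [lt_div_iff₀ hq] at h2
      push_cast at h2
      rw [Nat.floor_eq_iff (le_trans (by positivity) (by linarith : (i : ℝ) ≤ _))]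
      constructor <;> linarith
    simp only [approx, hfl, min_eq_left hi]
  · have hqx : (2 * (N : ℝ) + 1) * x = ((i + 1 : ℕ) : ℝ) := by
      rw [h2]; unfold nodeX; field_simp
    have hfl : ⌊(2 * (N : ℝ) + 1) * x⌋₊ = i + 1 := by rw [hqx, Nat.floor_natCast]
    have hone : (2 * (N : ℝ) + 1) * (x - nodeX N i) = 1 := by
      rw [h2]; unfold nodeX; push_cast; field_simp; ring
    rw [hone, approx_right hN, mul_one, add_sub_cancel]
    rcases hi.lt_or_eq with hi | hi
    · have hz : (2 * (N : ℝ) + 1) * (x - nodeX N (i + 1)) = 0 := by rw [h2]; ring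
      simp only [approx, hfl, min_eq_left (Nat.succ_le_of_lt hi), hz, approx_left]
      ring
    · subst hi
      have hx1 : x = 1 := by
        rw [h2]; unfold nodeX; push_cast; field_simp
      rw [hx1, approx_right hN, nodeY_odd, bParam_spec hN]

theorem bParam_mem {N : ℕ} (hN : 1 ≤ N) {a : ℝ} (ha : a ∈ Ioo (aMin N) 1) :
    0 < bParam N a ∧ bParam N a < a := by
  have hN0 : (1 : ℝ) ≤ N := by exact_mod_cast hN
  obtain ⟨h1, h2⟩ := ha
  unfold aMin at h1
  rw [div_lt_iff₀ (by positivity)] at h1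
  unfold bParam
  constructor
  · apply div_pos <;> linarith
  · rw [div_lt_iff₀ (by linarith)]; linarith

/-- The approximants converge to `F_{N,a}` uniformly on `[0, 1]`. -/
theorem tendstoUniformlyOn_F {N : ℕ} (hN : 1 ≤ N) {a : ℝ} (ha : a ∈ Ioo (aMin N) 1) :
    TendstoUniformlyOn (approx N a) (F N a) atTop (Icc 0 1) := by
  have hq : (0 : ℝ) < 2 * (N : ℝ) + 1 := by positivity
  obtain ⟨hb0, hba⟩ := bParam_mem hN ha
  have ha0 : 0 < a := hb0.trans hba
  have ha1 : a < 1 := ha.2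
  have hslope : ∀ i, |nodeY N a (i + 1) - nodeY N a i| ≤ a := by
    intro i
    rw [nodeY_slope]
    split_ifs
    · rw [abs_of_pos ha0]
    · rw [abs_neg, abs_of_pos hb0]; exact hba.le
  have hY : ∀ i, |nodeY N a i| ≤ i := by
    intro i
    induction i with
    | zero => simp [nodeY]
    | succ i ih =>
      have h1 := hslope i
      have h2 := abs_add_le (nodeY N a (i + 1) - nodeY N a i) (nodeY N a i)
      rw [sub_add_cancel] at h2
      push_cast
      linarith
  have hcell : ∀ x ∈ Icc (0 : ℝ) 1, ∃ i ≤ 2 * N, x ∈ Icc (nodeX N i) (nodeX N (i + 1)) := by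
    intro x hx
    refine ⟨min ⌊(2 * (N : ℝ) + 1) * x⌋₊ (2 * N), min_le_right _ _, ?_⟩
    have hnn : 0 ≤ (2 * (N : ℝ) + 1) * x := mul_nonneg hq.le hx.1
    have hf1 := Nat.floor_le hnn
    have hf2 := Nat.lt_floor_add_one ((2 * (N : ℝ) + 1) * x)
    unfold nodeX
    rw [mem_Icc, div_le_iff₀ hq, le_div_iff₀ hq]
    rcases le_total ⌊(2 * (N : ℝ) + 1) * x⌋₊ (2 * N) with h | h
    · rw [min_eq_left h]; push_cast; constructor <;> linarith
    · rw [min_eq_right h]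
      have h' : ((2 * N : ℕ) : ℝ) ≤ (⌊(2 * (N : ℝ) + 1) * x⌋₊ : ℝ) := by exact_mod_cast h
      push_cast at h' ⊢
      constructor
      · linarith
      · nlinarith [hx.2]
  have hres : ∀ (i : ℕ) (x : ℝ), x ∈ Icc (nodeX N i) (nodeX N (i + 1)) →
      (2 * (N : ℝ) + 1) * (x - nodeX N i) ∈ Icc (0 : ℝ) 1 := by
    intro i x hx
    have h1 : (2 * (N : ℝ) + 1) * nodeX N i = i := by unfold nodeX; field_simp
    have h2 : (2 * (N : ℝ) + 1) * nodeX N (i + 1) = i + 1 := by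
      unfold nodeX; push_cast; field_simp
    constructor
    · exact mul_nonneg hq.le (by linarith [hx.1])
    · have := mul_le_mul_of_nonneg_left hx.2 hq.le
      rw [mul_sub]; linarith
  set C : ℝ := 2 * (N : ℝ) + 2 with hC
  have hstep : ∀ n, ∀ x ∈ Icc (0 : ℝ) 1, |approx N a n x - approx N a (n + 1) x| ≤ C * a ^ n := by
    intro n
    induction n with
    | zero =>
      intro x hx
      obtain ⟨i, hi, hxi⟩ := hcell x hx
      obtain ⟨hr0, hr1⟩ := hres i x hxi
      rw [approx_succ_of_mem hN a 0 hi hxi]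
      simp only [approx]
      set r := (2 * (N : ℝ) + 1) * (x - nodeX N i)
      have h1 : |(nodeY N a (i + 1) - nodeY N a i) * r| ≤ 1 := by
        rw [abs_mul, abs_of_nonneg hr0]
        nlinarith [hslope i, abs_nonneg (nodeY N a (i + 1) - nodeY N a i)]
      have h2 := hY i
      have h3 : (i : ℝ) ≤ 2 * (N : ℝ) := by exact_mod_cast hi
      rw [abs_le] at h1 h2 ⊢
      rw [pow_zero, mul_one]
      constructor <;> linarith [hx.1, hx.2, h1.1, h1.2, h2.1, h2.2]
    | succ n ih =>
      intro x hx
      obtain ⟨i, hi, hxi⟩ := hcell x hx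
      rw [approx_succ_of_mem hN a n hi hxi, approx_succ_of_mem hN a (n + 1) hi hxi,
        add_sub_add_left_eq_sub, ← mul_sub, abs_mul]
      calc _ ≤ a * (C * a ^ n) :=
            mul_le_mul (hslope i) (ih _ (hres i x hxi)) (abs_nonneg _) ha0.le
        _ = C * a ^ (n + 1) := by ring
  have hbound : ∀ x ∈ Icc (0 : ℝ) 1, ∀ n,
      dist (approx N a n x) (F N a x) ≤ C * a ^ n / (1 - a) := by
    intro x hx n
    have hs : ∀ n, dist (approx N a n x) (approx N a (n + 1) x) ≤ C * a ^ n := by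
      intro n; rw [Real.dist_eq]; exact hstep n x hx
    have hc : CauchySeq (fun n => approx N a n x) := cauchySeq_of_le_geometric a C ha1 hs
    exact dist_le_of_le_geometric_of_tendsto a C ha1 hs (CauchySeq.tendsto_limUnder hc) n
  have hlim : Tendsto (fun n : ℕ => C * a ^ n / (1 - a)) atTop (𝓝 0) := by
    have := ((tendsto_pow_atTop_nhds_zero_of_lt_one ha0.le ha1).const_mul C).div_const (1 - a)
    simpa using this
  rw [Metric.tendstoUniformlyOn_iff]
  intro ε hε
  filter_upwards [hlim.eventually_lt_const hε] with n hn x hx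
  rw [dist_comm]
  exact (hbound x hx n).trans_lt hn

end OkamotoAllaart

open OkamotoAllaart

/-!
Write `q = 2N+1`. Everything is read off the slopes of the secants of `F` over the cells
`[k / q ^ n, (k + 1) / q ^ n]`. By self-affinity such a slope is the product of `n` factors, one
for each of the `n` base-`q` digits of `k`: `q a > 1` for an even digit and `-q b` for an odd one
(`cellSlope`, `F_cell_pow`).

*Pointwise.* If `F` has a derivative `L` at `x`, the slopes over the nested cells around `x` tend
to `L`; since the ratios of consecutive slopes stay away from `1`, this forces `L = 0`
(`IsAddress.deriv_eq_zero`). Conversely, slopes over adjacent cells of equal level differ at most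
by the factor `a / b` (`cellSlope_adjacent`), so if the slopes around `x` tend to zero, so do all
difference quotients at `x`. Hence `F` is differentiable at `x` exactly if the product of the
factors given by the digits of `x` tends to zero (`IsAddress.differentiableWithinAt_iff`).

*The two thresholds.* The condition `aStar N ≤ a` says `q b ≥ 1`, and then no such product tends
to zero. If `q b < 1`, sequences of digits with long runs of odd digits give uncountably many points
of differentiability, and long runs of even digits always give uncountably many points of
nondifferentiability. The condition `aTilde N ≤ a` says that the mean of the logarithms
`log (q a)` (`N + 1` digits) and `log (q b)` (`N` digits) is nonnegative.

*Almost everywhere.* For a random point the digits are independent and uniform; averages over the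
`q ^ n` cells of a level take the place of expectations (`lintegral_cellIndex`). If the mean
logarithm is negative, some power `|slope| ^ ε` has averages `r ^ n` with `r < 1`, so it is
summable along the levels at almost every point, and the slopes tend to zero. If the mean is
nonnegative, stop the logarithmic walk once it reaches `M`: the stopped walk is bounded above and
has nonnegative averages, so by Fatou's lemma it tends to `-∞` almost nowhere
(`ae_not_tendsto_stoppedLog`). A walk whose slopes tend to zero is bounded above and thus is
unaffected by the stopping for some `M : ℕ`, so slopes tend to zero almost nowhere. No distinction
between positive and zero mean is needed.
-/

namespace OkamotoAllaart

/-! ### The self-affine functional equation -/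

theorem tendsto_approx_F {N : ℕ} (hN : 1 ≤ N) {a : ℝ} (ha : a ∈ Ioo (aMin N) 1) {x : ℝ}
    (hx : x ∈ Icc (0 : ℝ) 1) : Tendsto (fun n => approx N a n x) atTop (𝓝 (F N a x)) :=
  (tendstoUniformlyOn_F hN ha).tendsto_at hx

theorem F_zero (N : ℕ) (a : ℝ) : F N a 0 = 0 := by
  simp only [F, approx_left]
  exact tendsto_const_nhds.limUnder_eq

theorem F_one {N : ℕ} (hN : 1 ≤ N) (a : ℝ) : F N a 1 = 1 := by
  simp only [F, approx_right hN]
  exact tendsto_const_nhds.limUnder_eq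

theorem nodeY_mem_Icc {N : ℕ} (hN : 1 ≤ N) {a : ℝ} (ha : a ∈ Ioo (aMin N) 1) {i : ℕ}
    (hi : i ≤ 2 * N + 1) : nodeY N a i ∈ Icc (0 : ℝ) 1 := by
  obtain ⟨hb0, hba⟩ := bParam_mem hN ha
  have hspec := bParam_spec hN a
  have ha1 := ha.2
  obtain ⟨j, rfl | rfl⟩ := Nat.even_or_odd' i
  · have hj : (j : ℝ) ≤ N := by exact_mod_cast (by omega : j ≤ N)
    rw [nodeY_even]
    constructor
    · exact mul_nonneg j.cast_nonneg (by linarith)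
    · nlinarith
  · have hj : (j : ℝ) ≤ N := by exact_mod_cast (by omega : j ≤ N)
    have hj0 : (0 : ℝ) ≤ j := j.cast_nonneg
    rw [nodeY_odd]
    constructor <;> nlinarith

theorem exists_mem_cell {N : ℕ} {x : ℝ} (hx : x ∈ Icc (0 : ℝ) 1) :
    ∃ i ≤ 2 * N, x ∈ Icc (nodeX N i) (nodeX N (i + 1)) := by
  have hq : (0 : ℝ) < 2 * (N : ℝ) + 1 := by positivity
  rcases hx.2.lt_or_eq with h | rfl
  · have hnn : 0 ≤ (2 * (N : ℝ) + 1) * x := mul_nonneg hq.le hx.1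
    refine ⟨⌊(2 * (N : ℝ) + 1) * x⌋₊, ?_, ?_, ?_⟩
    · have : ⌊(2 * (N : ℝ) + 1) * x⌋₊ < 2 * N + 1 := by
        rw [Nat.floor_lt hnn]; push_cast; nlinarith
      omega
    · rw [nodeX, div_le_iff₀ hq, mul_comm x]; exact Nat.floor_le hnn
    · rw [nodeX, le_div_iff₀ hq, mul_comm x]; push_cast; exact (Nat.lt_floor_add_one _).le
  · refine ⟨2 * N, le_rfl, ?_, ?_⟩
    · rw [nodeX, div_le_iff₀ hq]; push_cast; linarith
    · rw [nodeX, le_div_iff₀ hq]; push_cast; linarith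

theorem approx_mem_Icc {N : ℕ} (hN : 1 ≤ N) {a : ℝ} (ha : a ∈ Ioo (aMin N) 1) (n : ℕ) {x : ℝ}
    (hx : x ∈ Icc (0 : ℝ) 1) : approx N a n x ∈ Icc (0 : ℝ) 1 := by
  have hq : (0 : ℝ) < 2 * (N : ℝ) + 1 := by positivity
  induction n generalizing x with
  | zero => exact hx
  | succ n ih =>
    obtain ⟨i, hi, hxi⟩ := exists_mem_cell (N := N) hx
    rw [approx_succ_of_mem hN a n hi hxi]
    have ht : (2 * (N : ℝ) + 1) * (x - nodeX N i) ∈ Icc (0 : ℝ) 1 := by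
      obtain ⟨h1, h2⟩ := hxi
      unfold nodeX at h1 h2 ⊢
      rw [div_le_iff₀ hq] at h1
      rw [le_div_iff₀ hq] at h2
      push_cast at h2
      rw [mul_sub, mul_div_cancel₀ _ hq.ne']
      constructor <;> linarith
    have h := (convex_Icc (0 : ℝ) 1).add_smul_sub_mem
      (nodeY_mem_Icc hN ha (by omega : i ≤ 2 * N + 1))
      (nodeY_mem_Icc hN ha (by omega : i + 1 ≤ 2 * N + 1)) (ih ht)
    rwa [smul_eq_mul, mul_comm] at h

theorem F_mem_Icc {N : ℕ} (hN : 1 ≤ N) {a : ℝ} (ha : a ∈ Ioo (aMin N) 1) {x : ℝ}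
    (hx : x ∈ Icc (0 : ℝ) 1) : F N a x ∈ Icc (0 : ℝ) 1 :=
  isClosed_Icc.mem_of_tendsto (tendsto_approx_F hN ha hx)
    (Eventually.of_forall fun n => approx_mem_Icc hN ha n hx)

/-- The functional equation: on the `j`-th subinterval `F` is an affine copy of itself. -/
theorem F_cell {N : ℕ} (hN : 1 ≤ N) {a : ℝ} (ha : a ∈ Ioo (aMin N) 1) {j : ℕ} (hj : j ≤ 2 * N)
    {t : ℝ} (ht : t ∈ Icc (0 : ℝ) 1) :
    F N a ((j + t) / (2 * N + 1 : ℕ)) =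
      nodeY N a j + (nodeY N a (j + 1) - nodeY N a j) * F N a t := by
  have hq : (0 : ℝ) < 2 * (N : ℝ) + 1 := by positivity
  have hj' : (j : ℝ) ≤ 2 * N := by exact_mod_cast hj
  have hx : ((j + t) / (2 * N + 1 : ℕ) : ℝ) ∈ Icc (0 : ℝ) 1 := by
    push_cast
    rw [mem_Icc, div_le_one hq]
    have := ht.1
    exact ⟨by positivity, by linarith [ht.2]⟩
  have hxc : ((j + t) / (2 * N + 1 : ℕ) : ℝ) ∈ Icc (nodeX N j) (nodeX N (j + 1)) := by
    unfold nodeX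
    push_cast
    constructor <;> gcongr <;> linarith [ht.1, ht.2]
  have heq : (2 * (N : ℝ) + 1) * ((j + t) / (2 * N + 1 : ℕ) - nodeX N j) = t := by
    unfold nodeX; push_cast; field_simp; ring
  have h1 := (tendsto_add_atTop_iff_nat 1).2 (tendsto_approx_F hN ha hx)
  have h2 := ((tendsto_approx_F hN ha ht).const_mul (nodeY N a (j + 1) - nodeY N a j)).const_add
    (nodeY N a j)
  refine tendsto_nhds_unique h1 (h2.congr fun n => ?_)
  rw [approx_succ_of_mem hN a n hj hxc, heq]

/-! ### Slopes of the secants over the cells -/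

/-- The factor by which the slope of an approximant changes on passing to the subcell with
digit `j`: it is `(2N+1) a` for even `j` and `-(2N+1) b` for odd `j`. -/
noncomputable def digitSlope (N : ℕ) (a : ℝ) (j : ℕ) : ℝ :=
  (2 * N + 1 : ℕ) * (if Even j then a else -bParam N a)

/-- The slope of the secant of `F N a` over the cell `[k / q ^ n, (k + 1) / q ^ n]` of level `n`,
where `q = 2N+1`: the product of `digitSlope` over the `n` base-`q` digits of `k`. -/
noncomputable def cellSlope (N : ℕ) (a : ℝ) : ℕ → ℕ → ℝ
  | 0, _ => 1
  | n + 1, k => cellSlope N a n (k / (2 * N + 1)) * digitSlope N a (k % (2 * N + 1))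

/-- The functional equation, iterated: on every cell of level `n`, `F` is an affine copy of itself,
scaled vertically by the increment of `F` over the cell. -/
theorem F_cell_pow {N : ℕ} (hN : 1 ≤ N) {a : ℝ} (ha : a ∈ Ioo (aMin N) 1) (n : ℕ) {k : ℕ}
    (hk : k < (2 * N + 1) ^ n) {t : ℝ} (ht : t ∈ Icc (0 : ℝ) 1) :
    F N a ((k + t) / ((2 * N + 1 : ℕ) : ℝ) ^ n) =
      F N a (k / ((2 * N + 1 : ℕ) : ℝ) ^ n) +
        cellSlope N a n k / ((2 * N + 1 : ℕ) : ℝ) ^ n * F N a t := by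
  induction n generalizing k t with
  | zero =>
    obtain rfl : k = 0 := by simpa using hk
    simp [cellSlope, F_zero]
  | succ n ih =>
    set q := 2 * N + 1 with hqdef
    have hq : (0 : ℝ) < (q : ℝ) := by positivity
    have hj : k % q ≤ 2 * N := by have := Nat.mod_lt k (by omega : 0 < q); omega
    have hk' : k / q < q ^ n := by
      rw [Nat.div_lt_iff_lt_mul (by omega)]; rwa [pow_succ] at hk
    have hdm : (k : ℝ) = q * (k / q : ℕ) + (k % q : ℕ) := by
      exact_mod_cast (Nat.div_add_mod k q).symm
    have key : ∀ s ∈ Icc (0 : ℝ) 1, F N a ((k + s) / (q : ℝ) ^ (n + 1)) =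
        F N a ((k / q : ℕ) / (q : ℝ) ^ n) + cellSlope N a n (k / q) / (q : ℝ) ^ n *
          (nodeY N a (k % q) + (nodeY N a (k % q + 1) - nodeY N a (k % q)) * F N a s) := by
      intro s hs
      have hj' : ((k % q : ℕ) : ℝ) + 1 ≤ q := by
        exact_mod_cast (by omega : k % q + 1 ≤ q)
      have hs' : ((k % q : ℕ) + s) / (q : ℝ) ∈ Icc (0 : ℝ) 1 := by
        rw [mem_Icc, div_le_one hq]
        have := hs.1
        exact ⟨by positivity, by linarith [hs.2]⟩
      rw [← F_cell hN ha hj hs, ← ih hk' hs']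
      congr 1
      rw [hdm]
      field_simp
      ring
    have h0 := key 0 ⟨le_rfl, zero_le_one⟩
    rw [add_zero, F_zero, mul_zero, add_zero] at h0
    rw [key t ht, h0, cellSlope, digitSlope, nodeY_slope]
    field_simp
    ring

/-- `k` lists the indices of nested cells, one of each level `n`, that contain `x`. A point of
`(0, 1)` that is an endpoint of cells has two such addresses, all other points of `[0, 1]` have
exactly one. -/
structure IsAddress (N : ℕ) (x : ℝ) (k : ℕ → ℕ) : Prop where
  zero : k 0 = 0
  div : ∀ n, k (n + 1) / (2 * N + 1) = k n
  mem : ∀ n, x * ((2 * N + 1 : ℕ) : ℝ) ^ n ∈ Icc (k n : ℝ) (k n + 1)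

theorem IsAddress.lt {N : ℕ} {x : ℝ} {k : ℕ → ℕ} (h : IsAddress N x k) (n : ℕ) :
    k n < (2 * N + 1) ^ n := by
  induction n with
  | zero => simp [h.zero]
  | succ n ih =>
    rw [pow_succ, ← Nat.div_lt_iff_lt_mul (by omega), h.div]; exact ih

theorem isAddress_floor {N : ℕ} {x : ℝ} (hx : x ∈ Ico (0 : ℝ) 1) :
    IsAddress N x (fun n => ⌊x * ((2 * N + 1 : ℕ) : ℝ) ^ n⌋₊) where
  zero := by simpa using hx.2
  div n := by
    rw [← Nat.floor_div_natCast, pow_succ, ← mul_assoc, mul_div_cancel_right₀ _ (by positivity)]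
  mem n := ⟨Nat.floor_le (mul_nonneg hx.1 (by positivity)), (Nat.lt_floor_add_one _).le⟩

theorem isAddress_one (N : ℕ) : IsAddress N 1 (fun n => (2 * N + 1) ^ n - 1) where
  zero := by simp
  div n := by
    have h : 0 < (2 * N + 1) ^ n := by positivity
    have h2 : (2 * N + 1) ^ (n + 1) - 1 = 2 * N + (2 * N + 1) * ((2 * N + 1) ^ n - 1) := by
      rw [pow_succ, mul_comm]
      obtain ⟨m, hm⟩ := Nat.exists_eq_add_of_lt h
      rw [hm]
      simp [mul_add]
      omega
    rw [h2, Nat.add_mul_div_left _ _ (by omega), Nat.div_eq_of_lt (by omega), zero_add]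
  mem n := by
    have h : 1 ≤ (2 * N + 1) ^ n := Nat.one_le_pow _ _ (by omega)
    rw [Nat.cast_sub h]
    push_cast
    constructor <;> linarith

theorem exists_isAddress {N : ℕ} {x : ℝ} (hx : x ∈ Icc (0 : ℝ) 1) : ∃ k, IsAddress N x k := by
  rcases hx.2.lt_or_eq with h | rfl
  · exact ⟨_, isAddress_floor ⟨hx.1, h⟩⟩
  · exact ⟨_, isAddress_one N⟩

theorem IsAddress.cellSlope_succ {N : ℕ} {x : ℝ} {k : ℕ → ℕ} (h : IsAddress N x k) (a : ℝ)
    (n : ℕ) : cellSlope N a (n + 1) (k (n + 1)) =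
      cellSlope N a n (k n) * digitSlope N a (k (n + 1) % (2 * N + 1)) := by
  rw [cellSlope, h.div]

theorem digitSlope_abs {N : ℕ} (hN : 1 ≤ N) {a : ℝ} (ha : a ∈ Ioo (aMin N) 1) (j : ℕ) :
    |digitSlope N a j| = (2 * N + 1 : ℕ) * (if Even j then a else bParam N a) := by
  obtain ⟨hb0, hba⟩ := bParam_mem hN ha
  rw [digitSlope, abs_mul, Nat.abs_cast]
  split_ifs
  · rw [abs_of_pos (hb0.trans hba)]
  · rw [abs_neg, abs_of_pos hb0]

theorem digitSlope_ne_zero {N : ℕ} (hN : 1 ≤ N) {a : ℝ} (ha : a ∈ Ioo (aMin N) 1) (j : ℕ) :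
    digitSlope N a j ≠ 0 := by
  obtain ⟨hb0, hba⟩ := bParam_mem hN ha
  have ha0 := hb0.trans hba
  rw [← abs_pos, digitSlope_abs hN ha]
  split_ifs <;> positivity

theorem cellSlope_ne_zero {N : ℕ} (hN : 1 ≤ N) {a : ℝ} (ha : a ∈ Ioo (aMin N) 1) (n k : ℕ) :
    cellSlope N a n k ≠ 0 := by
  induction n generalizing k with
  | zero => exact one_ne_zero
  | succ n ih => exact mul_ne_zero (ih _) (digitSlope_ne_zero hN ha _)

/-- Slopes over neighbouring cells of the same level are comparable, uniformly in the level: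
the last digits of the two cells are `j, j + 1`, preceded by equal digits, or `2N, 0`, which are
both even and are preceded by the digits of two neighbouring cells. -/
theorem cellSlope_adjacent {N : ℕ} (hN : 1 ≤ N) {a : ℝ} (ha : a ∈ Ioo (aMin N) 1) (n k : ℕ) :
    |cellSlope N a n (k + 1)| ≤ a / bParam N a * |cellSlope N a n k| ∧
      |cellSlope N a n k| ≤ a / bParam N a * |cellSlope N a n (k + 1)| := by
  obtain ⟨hb0, hba⟩ := bParam_mem hN ha
  have ha0 := hb0.trans hba
  have h1 : 1 ≤ a / bParam N a := by rw [le_div_iff₀ hb0]; linarith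
  induction n generalizing k with
  | zero => simpa [cellSlope] using h1
  | succ n ih =>
    have hlt := Nat.mod_lt k (by omega : 0 < 2 * N + 1)
    have hdm := Nat.div_add_mod k (2 * N + 1)
    simp only [cellSlope, abs_mul]
    rcases Nat.lt_or_ge (k % (2 * N + 1) + 1) (2 * N + 1) with h | h
    · have hd : (k + 1) / (2 * N + 1) = k / (2 * N + 1) := by
        rw [← hdm, add_assoc, Nat.mul_add_div (by omega), Nat.mul_add_div (by omega),
          Nat.div_eq_of_lt h, Nat.div_eq_of_lt hlt]
      have hm : (k + 1) % (2 * N + 1) = k % (2 * N + 1) + 1 := by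
        rw [← Nat.mod_add_mod, Nat.mod_eq_of_lt h]
      rw [hd, hm, mul_left_comm, mul_left_comm (a / bParam N a)]
      have hkey : ∀ j, |digitSlope N a (j + 1)| ≤ a / bParam N a * |digitSlope N a j| ∧
          |digitSlope N a j| ≤ a / bParam N a * |digitSlope N a (j + 1)| := by
        intro j
        rw [digitSlope_abs hN ha, digitSlope_abs hN ha, mul_left_comm, mul_left_comm (a / _)]
        have hbb : a / bParam N a * bParam N a = a := div_mul_cancel₀ _ hb0.ne'
        have hab : bParam N a ≤ a / bParam N a * a := by nlinarith
        by_cases hj : Even j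
        · have hj' : ¬ Even (j + 1) := by simpa [Nat.even_add_one] using hj
          rw [if_pos hj, if_neg hj', hbb]
          exact ⟨by gcongr, le_rfl⟩
        · have hj' : Even (j + 1) := by simpa [Nat.even_add_one] using hj
          rw [if_neg hj, if_pos hj', hbb]
          exact ⟨le_rfl, by gcongr⟩
      obtain ⟨e1, e2⟩ := hkey (k % (2 * N + 1))
      constructor <;> gcongr
    · have hr : k % (2 * N + 1) = 2 * N := by omega
      have hk : k + 1 = (2 * N + 1) * (k / (2 * N + 1) + 1) := by
        rw [mul_add, mul_one]; omega
      have hd : (k + 1) / (2 * N + 1) = k / (2 * N + 1) + 1 := by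
        rw [hk, Nat.mul_div_cancel_left _ (by omega)]
      have hm : (k + 1) % (2 * N + 1) = 0 := by rw [hk, Nat.mul_mod_right]
      have he : digitSlope N a 0 = digitSlope N a (2 * N) := by simp [digitSlope]
      rw [hd, hm, hr, he, ← mul_assoc, ← mul_assoc]
      obtain ⟨e1, e2⟩ := ih (k / (2 * N + 1))
      constructor <;> gcongr

/-! ### Differentiability in terms of the slopes -/

/-- If `f` is differentiable at `x` within `s`, the slopes of its secants over intervals with
endpoints in `s` that contain `x` and shrink to `x` tend to the derivative. -/
theorem tendsto_secant_slope_of_straddle {f : ℝ → ℝ} {L x : ℝ} {s : Set ℝ}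
    (hf : HasDerivWithinAt f L s x) {u v : ℕ → ℝ} (hus : ∀ n, u n ∈ s) (hvs : ∀ n, v n ∈ s)
    (hux : ∀ n, u n ≤ x) (hxv : ∀ n, x ≤ v n) (huv : ∀ n, u n < v n)
    (hlim : Tendsto (fun n => v n - u n) atTop (𝓝 0)) :
    Tendsto (fun n => (f (v n) - f (u n)) / (v n - u n)) atTop (𝓝 L) := by
  rw [Metric.tendsto_atTop]
  intro ε hε
  have h1 := (hasDerivWithinAt_iff_isLittleO.1 hf).def (half_pos hε)
  rw [eventually_nhdsWithin_iff, Metric.eventually_nhds_iff] at h1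
  obtain ⟨δ, hδ, hd⟩ := h1
  obtain ⟨n₀, hn₀⟩ := (Metric.tendsto_atTop.1 hlim) δ hδ
  refine ⟨n₀, fun n hn => ?_⟩
  have hw := hn₀ n hn
  have hp : 0 < v n - u n := sub_pos.2 (huv n)
  rw [Real.dist_eq, sub_zero, abs_of_pos hp] at hw
  have hu := hd (y := u n) (by
    rw [Real.dist_eq, abs_lt]
    constructor <;> linarith [hux n, hxv n]) (hus n)
  have hv := hd (y := v n) (by
    rw [Real.dist_eq, abs_lt]
    constructor <;> linarith [hux n, hxv n]) (hvs n)
  rw [Real.norm_eq_abs, Real.norm_eq_abs, abs_of_nonpos (by linarith [hux n] : u n - x ≤ 0),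
    abs_le, smul_eq_mul] at hu
  rw [Real.norm_eq_abs, Real.norm_eq_abs, abs_of_nonneg (by linarith [hxv n] : 0 ≤ v n - x),
    abs_le, smul_eq_mul] at hv
  have heq : (f (v n) - f (u n)) / (v n - u n) - L =
      (f (v n) - f (u n) - (v n - u n) * L) / (v n - u n) := by field_simp
  rw [Real.dist_eq, heq, abs_div, abs_of_pos hp, div_lt_iff₀ hp, abs_lt]
  constructor <;> nlinarith [hu.1, hu.2, hv.1, hv.2]

variable {N : ℕ} {a x : ℝ} {k : ℕ → ℕ}

theorem IsAddress.mem_cell (hk : IsAddress N x k) (n : ℕ) :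
    ∃ t ∈ Icc (0 : ℝ) 1, x = (k n + t) / ((2 * N + 1 : ℕ) : ℝ) ^ n := by
  obtain ⟨h1, h2⟩ := hk.mem n
  refine ⟨x * ((2 * N + 1 : ℕ) : ℝ) ^ n - k n, ⟨by linarith, by linarith⟩, ?_⟩
  rw [add_sub_cancel, mul_div_cancel_right₀ _ (by positivity)]

theorem cell_left_mem {n m : ℕ} (hm : m ≤ (2 * N + 1) ^ n) :
    (m : ℝ) / ((2 * N + 1 : ℕ) : ℝ) ^ n ∈ Icc (0 : ℝ) 1 := by
  rw [mem_Icc, div_le_one (by positivity)]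
  exact ⟨by positivity, by exact_mod_cast hm⟩

theorem F_cell_right (hN : 1 ≤ N) (ha : a ∈ Ioo (aMin N) 1) (n : ℕ) {m : ℕ}
    (hm : m < (2 * N + 1) ^ n) :
    F N a ((m + 1 : ℕ) / ((2 * N + 1 : ℕ) : ℝ) ^ n) =
      F N a (m / ((2 * N + 1 : ℕ) : ℝ) ^ n) +
        cellSlope N a n m / ((2 * N + 1 : ℕ) : ℝ) ^ n := by
  have := F_cell_pow hN ha n hm (t := 1) ⟨zero_le_one, le_rfl⟩
  rw [F_one hN, mul_one] at this
  rw [← this, Nat.cast_succ]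

theorem one_lt_base (hN : 1 ≤ N) : (1 : ℝ) < ((2 * N + 1 : ℕ) : ℝ) := by
  exact_mod_cast (by omega : 1 < 2 * N + 1)

/-- The slopes over the cells around `x` tend to the derivative at `x`, if there is one. -/
theorem IsAddress.tendsto_cellSlope (hN : 1 ≤ N) (ha : a ∈ Ioo (aMin N) 1)
    (hk : IsAddress N x k) {L : ℝ} (hL : HasDerivWithinAt (F N a) L (Icc 0 1) x) :
    Tendsto (fun n => cellSlope N a n (k n)) atTop (𝓝 L) := by
  have hdiff : ∀ n, ((k n + 1 : ℕ) : ℝ) / ((2 * N + 1 : ℕ) : ℝ) ^ n -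
      (k n : ℝ) / ((2 * N + 1 : ℕ) : ℝ) ^ n = (((2 * N + 1 : ℕ) : ℝ)⁻¹) ^ n := by
    intro n; rw [Nat.cast_succ, ← sub_div, add_sub_cancel_left, inv_pow, one_div]
  have h := tendsto_secant_slope_of_straddle hL
    (u := fun n => (k n : ℝ) / ((2 * N + 1 : ℕ) : ℝ) ^ n)
    (v := fun n => ((k n + 1 : ℕ) : ℝ) / ((2 * N + 1 : ℕ) : ℝ) ^ n)
    (fun n => cell_left_mem (hk.lt n).le) (fun n => cell_left_mem (hk.lt n))
    (fun n => by rw [div_le_iff₀ (by positivity)]; exact (hk.mem n).1)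
    (fun n => by rw [le_div_iff₀ (by positivity), Nat.cast_succ (k n)]; exact (hk.mem n).2)
    (fun n => by rw [← sub_pos, hdiff]; positivity)
    (by
      simp only [hdiff]
      exact tendsto_pow_atTop_nhds_zero_of_lt_one (by positivity)
        (inv_lt_one_of_one_lt₀ (one_lt_base hN)))
  refine h.congr fun n => ?_
  rw [hdiff, F_cell_right hN ha n (hk.lt n), add_sub_cancel_left, inv_pow,
    div_inv_eq_mul, div_mul_cancel₀ _ (by positivity)]

theorem one_lt_base_mul (hN : 1 ≤ N) (ha : a ∈ Ioo (aMin N) 1) :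
    1 < ((2 * N + 1 : ℕ) : ℝ) * a := by
  have h := ha.1
  have hN0 : (1 : ℝ) ≤ N := by exact_mod_cast hN
  rw [aMin, div_lt_iff₀ (by positivity)] at h
  have : 0 < a := (bParam_mem hN ha).1.trans (bParam_mem hN ha).2
  push_cast
  nlinarith

/-- A derivative of `F` can only be zero: a nonzero limit of the slopes over nested cells would
force the ratios of consecutive slopes to tend to `1`, but these ratios are `(2N+1) a > 1` or
`-(2N+1) b < 0`. -/
theorem IsAddress.deriv_eq_zero (hN : 1 ≤ N) (ha : a ∈ Ioo (aMin N) 1)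
    (hk : IsAddress N x k) {L : ℝ} (hL : HasDerivWithinAt (F N a) L (Icc 0 1) x) : L = 0 := by
  by_contra hL0
  have hlim := hk.tendsto_cellSlope hN ha hL
  have hratio : Tendsto (fun n => digitSlope N a (k (n + 1) % (2 * N + 1))) atTop (𝓝 1) := by
    have h := ((tendsto_add_atTop_iff_nat 1).2 hlim).div hlim hL0
    rw [div_self hL0] at h
    refine h.congr fun n => ?_
    rw [Pi.div_apply, hk.cellSlope_succ, mul_div_cancel_left₀ _ (cellSlope_ne_zero hN ha _ _)]
  have hqa := one_lt_base_mul hN ha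
  have hpos := hratio.eventually_const_lt (zero_lt_one)
  have hlt := hratio.eventually_lt_const hqa
  obtain ⟨n, h1, h2⟩ := (hpos.and hlt).exists
  rw [digitSlope] at h1 h2
  split_ifs at h1 h2
  · exact lt_irrefl _ h2
  · have : 0 ≤ ((2 * N + 1 : ℕ) : ℝ) * bParam N a :=
      mul_nonneg (Nat.cast_nonneg _) (bParam_mem hN ha).1.le
    linarith

/-- Over a cell `F` stays between its values at the endpoints, as `F` has values in `[0, 1]`. -/
theorem abs_F_sub_cell_le (hN : 1 ≤ N) (ha : a ∈ Ioo (aMin N) 1) (hk : IsAddress N x k) (n : ℕ) :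
    |F N a x - F N a (k n / ((2 * N + 1 : ℕ) : ℝ) ^ n)| ≤
        |cellSlope N a n (k n)| / ((2 * N + 1 : ℕ) : ℝ) ^ n ∧
      |F N a x - F N a ((k n + 1 : ℕ) / ((2 * N + 1 : ℕ) : ℝ) ^ n)| ≤
        |cellSlope N a n (k n)| / ((2 * N + 1 : ℕ) : ℝ) ^ n := by
  obtain ⟨t, ht, hx⟩ := hk.mem_cell n
  obtain ⟨hF0, hF1⟩ := F_mem_Icc hN ha ht
  have hx' := F_cell_pow hN ha n (hk.lt n) ht
  rw [← hx] at hx'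
  have hpow : |((2 * N + 1 : ℕ) : ℝ) ^ n| = ((2 * N + 1 : ℕ) : ℝ) ^ n :=
    abs_of_nonneg (by positivity)
  constructor
  · rw [hx', add_sub_cancel_left, abs_mul, abs_div, hpow]
    exact mul_le_of_le_one_right (by positivity) (by rw [abs_le]; constructor <;> linarith)
  · rw [hx', F_cell_right hN ha n (hk.lt n), add_sub_add_left_eq_sub, ← mul_sub_one, abs_mul,
      abs_div, hpow]
    exact mul_le_of_le_one_right (by positivity) (by rw [abs_le]; constructor <;> linarith)

/-- Points at distance less than `q⁻ⁿ`, with `q = 2N+1`, lie in equal or adjacent cells of level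
`n`, so the increment of `F` between them is controlled by the slope over a single cell. -/
theorem abs_F_sub_le (hN : 1 ≤ N) (ha : a ∈ Ioo (aMin N) 1) (hk : IsAddress N x k) {y : ℝ}
    (hy : y ∈ Icc (0 : ℝ) 1) {n : ℕ} (hxy : |y - x| * ((2 * N + 1 : ℕ) : ℝ) ^ n < 1) :
    |F N a y - F N a x| ≤
      (1 + a / bParam N a) * |cellSlope N a n (k n)| / ((2 * N + 1 : ℕ) : ℝ) ^ n := by
  obtain ⟨l, hl⟩ := exists_isAddress (N := N) hy
  obtain ⟨hb0, hba⟩ := bParam_mem hN ha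
  have h1 : 1 ≤ a / bParam N a := by rw [le_div_iff₀ hb0]; linarith
  have hpos : (0 : ℝ) < ((2 * N + 1 : ℕ) : ℝ) ^ n := by positivity
  obtain ⟨x1, x2⟩ := hk.mem n
  obtain ⟨y1, y2⟩ := hl.mem n
  have hd : |y * ((2 * N + 1 : ℕ) : ℝ) ^ n - x * ((2 * N + 1 : ℕ) : ℝ) ^ n| < 1 := by
    rwa [← sub_mul, abs_mul, abs_of_pos hpos]
  rw [abs_lt] at hd
  have hlk : l n < k n + 2 := by
    have : (l n : ℝ) < (k n : ℝ) + 2 := by linarith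
    exact_mod_cast this
  have hkl : k n < l n + 2 := by
    have : (k n : ℝ) < (l n : ℝ) + 2 := by linarith
    exact_mod_cast this
  obtain ⟨bx0, bx1⟩ := abs_F_sub_cell_le hN ha hk n
  obtain ⟨by0, by1⟩ := abs_F_sub_cell_le hN ha hl n
  -- It suffices to find a common endpoint of the two cells.
  have fin : ∀ z m : ℝ, |F N a x - z| ≤ |cellSlope N a n (k n)| / ((2 * N + 1 : ℕ) : ℝ) ^ n →
      |F N a y - z| ≤ m / ((2 * N + 1 : ℕ) : ℝ) ^ n →
      m ≤ a / bParam N a * |cellSlope N a n (k n)| → |F N a y - F N a x| ≤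
      (1 + a / bParam N a) * |cellSlope N a n (k n)| / ((2 * N + 1 : ℕ) : ℝ) ^ n := by
    intro z m hx hy hm
    calc |F N a y - F N a x| ≤ |F N a y - z| + |F N a x - z| := by
          rw [abs_sub_comm (F N a x)]; exact abs_sub_le _ _ _
      _ ≤ m / ((2 * N + 1 : ℕ) : ℝ) ^ n +
          |cellSlope N a n (k n)| / ((2 * N + 1 : ℕ) : ℝ) ^ n := add_le_add hy hx
      _ = (m + |cellSlope N a n (k n)|) / ((2 * N + 1 : ℕ) : ℝ) ^ n := by rw [add_div]
      _ ≤ _ := by gcongr; linarith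
  rcases (by omega : l n = k n ∨ l n = k n + 1 ∨ k n = l n + 1) with h | h | h
  · rw [h] at by0
    exact fin _ _ bx0 by0 (le_mul_of_one_le_left (abs_nonneg _) h1)
  · rw [h] at by0
    exact fin _ _ bx1 by0 (cellSlope_adjacent hN ha n (k n)).1
  · rw [← h] at by1
    refine fin _ _ bx0 by1 ?_
    rw [h]
    exact (cellSlope_adjacent hN ha n (l n)).2

theorem IsAddress.hasDerivWithinAt_zero (hN : 1 ≤ N) (ha : a ∈ Ioo (aMin N) 1)
    (hk : IsAddress N x k) (hlim : Tendsto (fun n => cellSlope N a n (k n)) atTop (𝓝 0)) :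
    HasDerivWithinAt (F N a) 0 (Icc 0 1) x := by
  obtain ⟨hb0, hba⟩ := bParam_mem hN ha
  have ha0 := hb0.trans hba
  set q : ℝ := ((2 * N + 1 : ℕ) : ℝ) with hqdef
  have hq1 : 1 < q := one_lt_base hN
  have hq0 : 0 < q := by linarith
  set C : ℝ := (1 + a / bParam N a) * q ^ 2 with hC
  have hCpos : 0 < C := by positivity
  rw [hasDerivWithinAt_iff_isLittleO, Asymptotics.isLittleO_iff]
  intro ε hε
  obtain ⟨n₀, hn₀⟩ := Metric.tendsto_atTop.1 hlim (ε / C) (by positivity)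
  rw [eventually_nhdsWithin_iff, Metric.eventually_nhds_iff]
  refine ⟨q⁻¹ ^ (n₀ + 1), by positivity, fun y hyx hy => ?_⟩
  simp only [smul_zero, sub_zero, Real.norm_eq_abs]
  rcases eq_or_ne y x with rfl | hne
  · simp
  have hpos : 0 < |y - x| := abs_pos.2 (sub_ne_zero.2 hne)
  rw [Real.dist_eq] at hyx
  have hinv1 : q⁻¹ < 1 := inv_lt_one_of_one_lt₀ hq1
  -- With `m = n + 1`, `q⁻¹ ^ (n + 2) < |y - x| ≤ q⁻¹ ^ (n + 1)`: the lower bound accounts for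
  -- `q ^ 2` in `C`, the upper one puts `x` and `y` into equal or adjacent cells of level `n`.
  obtain ⟨m, hm1, hm2⟩ := exists_nat_pow_near_of_lt_one hpos
    (hyx.le.trans (pow_le_one₀ (by positivity) hinv1.le)) (by positivity) hinv1
  have hmn : n₀ < m := by
    by_contra hcon
    have := pow_le_pow_of_le_one (by positivity) hinv1.le (by omega : m + 1 ≤ n₀ + 1)
    linarith
  obtain ⟨n, rfl⟩ : ∃ n, m = n + 1 := ⟨m - 1, by omega⟩
  have hsmall : |y - x| * q ^ n < 1 := by
    calc |y - x| * q ^ n ≤ q⁻¹ ^ (n + 1) * q ^ n := by gcongr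
      _ = q⁻¹ := by rw [inv_pow, pow_succ]; field_simp
      _ < 1 := hinv1
  have hslope := hn₀ n (by omega)
  rw [Real.dist_eq, sub_zero, lt_div_iff₀ hCpos] at hslope
  calc |F N a y - F N a x| ≤ (1 + a / bParam N a) * |cellSlope N a n (k n)| / q ^ n :=
        abs_F_sub_le hN ha hk hy hsmall
    _ = |cellSlope N a n (k n)| * C * q⁻¹ ^ (n + 1 + 1) := by
        rw [hC, inv_pow, add_assoc, pow_add]; field_simp
    _ ≤ ε * q⁻¹ ^ (n + 1 + 1) := by gcongr
    _ ≤ ε * |y - x| := by gcongr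

/-- `F` is differentiable at `x` exactly if the slopes over the cells around `x` tend to zero. -/
theorem IsAddress.differentiableWithinAt_iff (hN : 1 ≤ N) (ha : a ∈ Ioo (aMin N) 1)
    (hk : IsAddress N x k) : DifferentiableWithinAt ℝ (F N a) (Icc 0 1) x ↔
      Tendsto (fun n => cellSlope N a n (k n)) atTop (𝓝 0) := by
  refine ⟨fun h => ?_, fun h => (hk.hasDerivWithinAt_zero hN ha h).differentiableWithinAt⟩
  have h1 := hk.tendsto_cellSlope hN ha h.hasDerivWithinAt
  rwa [hk.deriv_eq_zero hN ha h.hasDerivWithinAt] at h1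

theorem IsAddress.abs_cellSlope_succ (hN : 1 ≤ N) (ha : a ∈ Ioo (aMin N) 1)
    (hk : IsAddress N x k) (n : ℕ) : |cellSlope N a (n + 1) (k (n + 1))| =
      |cellSlope N a n (k n)| * (((2 * N + 1 : ℕ) : ℝ) *
        (if Even (k (n + 1) % (2 * N + 1)) then a else bParam N a)) := by
  rw [hk.cellSlope_succ, abs_mul, digitSlope_abs hN ha]

/-! ### The parameter thresholds -/

theorem aStar_le_iff (hN : 1 ≤ N) :
    aStar N ≤ a ↔ 1 ≤ ((2 * N + 1 : ℕ) : ℝ) * bParam N a := by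
  have hN0 : (0 : ℝ) < N := by exact_mod_cast hN
  rw [aStar, bParam, div_le_iff₀ (by positivity), ← mul_div_assoc, one_le_div hN0]
  push_cast
  constructor <;> intro h <;> linarith

theorem not_differentiableWithinAt_of_aStar_le (hN : 1 ≤ N) (ha : a ∈ Ioo (aMin N) 1)
    (hs : aStar N ≤ a) (hx : x ∈ Icc (0 : ℝ) 1) :
    ¬ DifferentiableWithinAt ℝ (F N a) (Icc 0 1) x := by
  obtain ⟨k, hk⟩ := exists_isAddress (N := N) hx
  rw [hk.differentiableWithinAt_iff hN ha]
  have hqb := (aStar_le_iff hN).1 hs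
  have hge : ∀ n, 1 ≤ |cellSlope N a n (k n)| := by
    intro n
    induction n with
    | zero => simp [cellSlope]
    | succ n ih =>
      rw [hk.abs_cellSlope_succ hN ha]
      refine one_le_mul_of_one_le_of_one_le ih ?_
      split_ifs
      · exact (one_lt_base_mul hN ha).le
      · exact hqb
  intro h
  exact absurd (ge_of_tendsto' h.abs hge) (by norm_num)

/-- The defining equation of `aTilde N` says `(q a) ^ (N + 1) * (q b) ^ N = 1` with `q = 2N+1`, and
the left side increases with `a`; its logarithm is the sum of `log |digitSlope|` over all digits. -/
theorem aTilde_le_iff (hN : 1 ≤ N) (ha : a ∈ Ioo (aMin N) 1) :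
    aTilde N ≤ a ↔ 0 ≤ ((N : ℝ) + 1) * Real.log (((2 * N + 1 : ℕ) : ℝ) * a) +
      N * Real.log (((2 * N + 1 : ℕ) : ℝ) * bParam N a) := by
  have hN0 : (0 : ℝ) < N := by exact_mod_cast hN
  set q : ℝ := ((2 * N + 1 : ℕ) : ℝ) with hq
  have hq0 : 0 < q := by positivity
  have hmono : StrictMonoOn (fun t => (q * t) ^ (N + 1) * (q * bParam N t) ^ N)
      (Ioo (aMin N) 1) := by
    intro s hs t ht hst
    obtain ⟨hb0, hbs⟩ := bParam_mem hN hs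
    have hs0 : 0 < s := hb0.trans hbs
    have hb : bParam N s < bParam N t := by
      unfold bParam
      gcongr
    have hN' : N ≠ 0 := by omega
    dsimp only
    gcongr
  have hth := isThreshold_aTilde hN
  have hone : (q * aTilde N) ^ (N + 1) * (q * bParam N (aTilde N)) ^ N = 1 := by
    have h2 := hth.2
    have h3 : ((N : ℝ) + 1) * aTilde N - 1 = N * bParam N (aTilde N) := by
      linarith [bParam_spec hN (aTilde N)]
    rw [h3] at h2
    have hqq : 2 * (N : ℝ) + 1 = q := by rw [hq]; push_cast; ring
    rw [hqq, mul_pow (N : ℝ)] at h2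
    have hNN : (0 : ℝ) < (N : ℝ) ^ N := by positivity
    refine mul_right_cancel₀ hNN.ne' ?_
    rw [one_mul]
    refine Eq.trans ?_ h2
    ring
  obtain ⟨hb0, hba⟩ := bParam_mem hN ha
  have ha0 : 0 < a := hb0.trans hba
  rw [← hmono.le_iff_le hth.1 ha]
  rw [hone, ← Real.log_nonneg_iff (by positivity), Real.log_mul (by positivity) (by positivity),
    Real.log_pow, Real.log_pow]
  push_cast
  rfl

/-! ### Uncountable families of points with prescribed digits -/

/-- The point whose base-`(2N+1)` digits are `0` and `1`, according to `e`. -/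
noncomputable def cantorPoint (N : ℕ) (e : ℕ → Bool) : ℝ :=
  (((2 * N + 1 : ℕ) : ℝ))⁻¹ * Cardinal.cantorFunction (((2 * N + 1 : ℕ) : ℝ))⁻¹ e

theorem base_inv_le (hN : 1 ≤ N) : (((2 * N + 1 : ℕ) : ℝ))⁻¹ ≤ 1 / 3 := by
  have hN0 : (1 : ℝ) ≤ N := by exact_mod_cast hN
  rw [one_div]
  gcongr
  push_cast
  linarith

theorem cantorPoint_injective (hN : 1 ≤ N) : Function.Injective (cantorPoint N) := by
  have h := base_inv_le hN
  intro e e' hee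
  exact Cardinal.cantorFunction_injective (c := (((2 * N + 1 : ℕ) : ℝ))⁻¹) (by positivity)
    (by linarith) (mul_left_cancel₀ (by positivity) hee)

theorem cantorPoint_succ (hN : 1 ≤ N) (e : ℕ → Bool) :
    cantorPoint N e * ((2 * N + 1 : ℕ) : ℝ) = (e 0).toNat + cantorPoint N (fun n => e (n + 1)) := by
  have h := base_inv_le hN
  rw [cantorPoint, mul_right_comm, inv_mul_cancel₀ (by positivity), one_mul,
    Cardinal.cantorFunction_succ e (by positivity) (by linarith), cantorPoint]
  cases e 0 <;> simp

theorem cantorPoint_mem (hN : 1 ≤ N) (e : ℕ → Bool) : cantorPoint N e ∈ Ico (0 : ℝ) 1 := by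
  have h := base_inv_le hN
  have h0 : (0 : ℝ) ≤ (((2 * N + 1 : ℕ) : ℝ))⁻¹ := by positivity
  set c := (((2 * N + 1 : ℕ) : ℝ))⁻¹ with hc
  have hle := Cardinal.cantorFunction_le (f := e) (g := fun _ => true) h0 (by linarith)
    (fun _ _ => rfl)
  have htop : Cardinal.cantorFunction c (fun _ => true) = (1 - c)⁻¹ := by
    simp [Cardinal.cantorFunction, tsum_geometric_of_lt_one h0 (by linarith : c < 1)]
  have hnn : 0 ≤ Cardinal.cantorFunction c e :=
    tsum_nonneg fun _ => Cardinal.cantorFunctionAux_nonneg h0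
  have hinv : (1 - c)⁻¹ ≤ 2 := by
    rw [inv_le_comm₀ (by linarith) (by norm_num)]; linarith
  rw [htop] at hle
  refine ⟨mul_nonneg h0 hnn, ?_⟩
  rw [cantorPoint, ← hc]
  nlinarith

/-- The address of `cantorPoint N e`. -/
def cantorAddress (N : ℕ) (e : ℕ → Bool) : ℕ → ℕ
  | 0 => 0
  | n + 1 => (2 * N + 1) * cantorAddress N e n + (e n).toNat

theorem cantorAddress_mod (hN : 1 ≤ N) (e : ℕ → Bool) (n : ℕ) :
    cantorAddress N e (n + 1) % (2 * N + 1) = (e n).toNat := by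
  rw [cantorAddress, Nat.mul_add_mod, Nat.mod_eq_of_lt]
  have := Bool.toNat_le (e n)
  omega

theorem isAddress_cantorPoint (hN : 1 ≤ N) (e : ℕ → Bool) :
    IsAddress N (cantorPoint N e) (cantorAddress N e) := by
  have key : ∀ n, cantorPoint N e * ((2 * N + 1 : ℕ) : ℝ) ^ n =
      cantorAddress N e n + cantorPoint N (fun m => e (m + n)) := by
    intro n
    induction n with
    | zero => simp [cantorAddress]
    | succ n ih =>
      rw [pow_succ, ← mul_assoc, ih, add_mul, cantorPoint_succ hN, cantorAddress, zero_add]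
      simp only [Nat.add_right_comm _ 1 n, ← add_assoc]
      push_cast
      ring
  refine ⟨rfl, fun n => ?_, fun n => ?_⟩
  · have := Bool.toNat_le (e n)
    rw [cantorAddress, Nat.mul_add_div (by omega), Nat.div_eq_of_lt (by omega), add_zero]
  · rw [key]
    obtain ⟨h0, h1⟩ := cantorPoint_mem hN (fun m => e (m + n))
    constructor <;> linarith

theorem not_countable_nat_bool : ¬ Countable (ℕ → Bool) := by
  rw [← Cardinal.mk_le_aleph0_iff, not_le]
  simpa using Cardinal.cantor Cardinal.aleph0

/-- Prescribing all digits of a point of `(0, 1)` to be `c`, except those at positions that are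
multiples of `K + 1`, leaves uncountably many points: the remaining digits can be `0` or `1`
freely. -/
theorem not_countable_of_digits (hN : 1 ≤ N) {P : ℝ → Prop} (K : ℕ) (c : Bool)
    (h : ∀ x k, IsAddress N x k →
      (∀ n, ¬ K + 1 ∣ n → k (n + 1) % (2 * N + 1) = c.toNat) → P x) :
    ¬ {x ∈ Ioo (0 : ℝ) 1 | P x}.Countable := by
  intro hcount
  -- The sequence of digits may be constantly zero, so the point `0` is added.
  have hcount' := hcount.insert 0
  set d : (ℕ → Bool) → ℕ → Bool := fun f n => if K + 1 ∣ n then f (n / (K + 1)) else c with hd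
  have hdinj : Function.Injective d := by
    intro f g hfg
    funext n
    have := congrFun hfg ((K + 1) * n)
    simpa [hd] using this
  have hinj : Function.Injective (fun f => cantorPoint N (d f)) :=
    (cantorPoint_injective hN).comp hdinj
  have hmem : ∀ f, cantorPoint N (d f) ∈ insert 0 {x ∈ Ioo (0 : ℝ) 1 | P x} := by
    intro f
    obtain ⟨h0, h1⟩ := cantorPoint_mem hN (d f)
    rcases h0.eq_or_lt with h0 | h0
    · exact Or.inl h0.symm
    · refine Or.inr ⟨⟨h0, h1⟩, h _ _ (isAddress_cantorPoint hN (d f)) fun n hn => ?_⟩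
      rw [cantorAddress_mod hN]
      simp [hd, hn]
  have hpre := hcount'.preimage_of_injOn (f := fun f => cantorPoint N (d f)) hinj.injOn
  have huniv : (fun f => cantorPoint N (d f)) ⁻¹' (insert 0 {x ∈ Ioo (0 : ℝ) 1 | P x}) = univ :=
    eq_univ_of_forall hmem
  rw [huniv] at hpre
  exact not_countable_nat_bool (countable_univ_iff.1 hpre)

/-- A nonnegative sequence that is multiplied by at most `v` at each step, except that the steps
at multiples of `K + 1` may multiply it by `W`, tends to zero if `W * v ^ K < 1`. -/
theorem tendsto_zero_of_blocks {A : ℕ → ℝ} {W v : ℝ} {K : ℕ} (hA : ∀ n, 0 ≤ A n) (hW : 0 ≤ W)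
    (hv : 0 ≤ v) (hv1 : v ≤ 1) (h1 : ∀ n, A (n + 1) ≤ A n * W)
    (h2 : ∀ n, ¬ K + 1 ∣ n → A (n + 1) ≤ A n * v) (hlt : W * v ^ K < 1) :
    Tendsto A atTop (𝓝 0) := by
  have hblock : ∀ j r, r ≤ K → A ((K + 1) * j + (r + 1)) ≤ A ((K + 1) * j) * (W * v ^ r) := by
    intro j r hr
    induction r with
    | zero => simpa using h1 ((K + 1) * j)
    | succ r ih =>
      have hnd : ¬ K + 1 ∣ (K + 1) * j + (r + 1) := by
        rw [Nat.dvd_add_right (dvd_mul_right _ _)]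
        exact Nat.not_dvd_of_pos_of_lt (by omega) (by omega)
      calc A ((K + 1) * j + (r + 1 + 1)) ≤ A ((K + 1) * j + (r + 1)) * v := h2 _ hnd
        _ ≤ A ((K + 1) * j) * (W * v ^ r) * v := by gcongr; exact ih (by omega)
        _ = _ := by ring
  have hpow : ∀ j, A ((K + 1) * j) ≤ A 0 * (W * v ^ K) ^ j := by
    intro j
    induction j with
    | zero => simp
    | succ j ih =>
      calc A ((K + 1) * (j + 1)) ≤ A ((K + 1) * j) * (W * v ^ K) := hblock j K le_rfl
        _ ≤ A 0 * (W * v ^ K) ^ j * (W * v ^ K) := by gcongr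
        _ = _ := by ring
  have hbound : ∀ n, A n ≤ A 0 * (W * v ^ K) ^ (n / (K + 1)) * (W + 1) := by
    intro n
    have hdm := Nat.div_add_mod n (K + 1)
    have hml := Nat.mod_lt n (by omega : 0 < K + 1)
    set j := n / (K + 1)
    have hle : A n ≤ A ((K + 1) * j) * (W + 1) := by
      rcases Nat.eq_zero_or_pos (n % (K + 1)) with h0 | h0
      · rw [h0, add_zero] at hdm
        rw [hdm]
        nlinarith [hA n]
      · have hb := hblock j (n % (K + 1) - 1) (by omega)
        rw [Nat.sub_add_cancel h0, hdm] at hb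
        refine hb.trans (mul_le_mul_of_nonneg_left ?_ (hA _))
        have := mul_le_of_le_one_right hW (pow_le_one₀ (n := n % (K + 1) - 1) hv hv1)
        linarith
    exact hle.trans (by gcongr; exact hpow j)
  have hdiv : Tendsto (fun n => n / (K + 1)) atTop atTop :=
    Nat.tendsto_div_const_atTop (by omega)
  have hlim := (((tendsto_pow_atTop_nhds_zero_of_lt_one (by positivity) hlt).comp hdiv).const_mul
    (A 0)).mul_const (W + 1)
  rw [mul_zero, zero_mul] at hlim
  exact squeeze_zero hA hbound hlim

theorem differentiableAt_iff_within (hx : x ∈ Ioo (0 : ℝ) 1) :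
    DifferentiableAt ℝ (F N a) x ↔ DifferentiableWithinAt ℝ (F N a) (Icc 0 1) x :=
  ⟨fun h => h.differentiableWithinAt,
    fun h => h.differentiableAt (Icc_mem_nhds hx.1 hx.2)⟩

theorem exists_pow_mul_lt_one {v : ℝ} (hv : 0 ≤ v) (hv1 : v < 1) (W : ℝ) :
    ∃ K : ℕ, W * v ^ K < 1 := by
  have h := (tendsto_pow_atTop_nhds_zero_of_lt_one hv hv1).const_mul W
  rw [mul_zero] at h
  exact (h.eventually_lt_const one_pos).exists

/-- If `(2N+1) b < 1`, long runs of odd digits make the slopes tend to zero, whatever the digits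
in between. -/
theorem not_countable_differentiableAt (hN : 1 ≤ N) (ha : a ∈ Ioo (aMin N) 1)
    (hs : a < aStar N) : ¬ {x ∈ Ioo (0 : ℝ) 1 | DifferentiableAt ℝ (F N a) x}.Countable := by
  obtain ⟨hb0, hba⟩ := bParam_mem hN ha
  have ha0 := hb0.trans hba
  have hv1 : ((2 * N + 1 : ℕ) : ℝ) * bParam N a < 1 := by
    rw [← not_le, ← aStar_le_iff hN]; exact not_le.2 hs
  obtain ⟨K, hK⟩ := exists_pow_mul_lt_one (by positivity) hv1 (((2 * N + 1 : ℕ) : ℝ) * a)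
  have key := not_countable_of_digits (P := fun x =>
    DifferentiableWithinAt ℝ (F N a) (Icc 0 1) x) hN K true fun x k hk hdig => by
      rw [hk.differentiableWithinAt_iff hN ha, tendsto_zero_iff_abs_tendsto_zero]
      refine tendsto_zero_of_blocks (fun _ => abs_nonneg _) (by positivity) (by positivity) hv1.le
        (fun n => ?_) (fun n hn => ?_) hK
      · rw [Function.comp_apply, hk.abs_cellSlope_succ hN ha]
        dsimp only [Function.comp_apply]
        gcongr
        split_ifs
        exacts [le_rfl, hba.le]
      · rw [Function.comp_apply, hk.abs_cellSlope_succ hN ha, hdig n hn]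
        simp
  convert key using 4 with x
  exact and_congr_right fun hx => differentiableAt_iff_within hx

/-- Long runs of even digits make the slopes tend to infinity, whatever the digits in between. -/
theorem not_countable_not_differentiableAt (hN : 1 ≤ N) (ha : a ∈ Ioo (aMin N) 1) :
    ¬ {x ∈ Ioo (0 : ℝ) 1 | ¬ DifferentiableAt ℝ (F N a) x}.Countable := by
  obtain ⟨hb0, hba⟩ := bParam_mem hN ha
  have ha0 := hb0.trans hba
  have hv1 : (((2 * N + 1 : ℕ) : ℝ) * a)⁻¹ < 1 := inv_lt_one_of_one_lt₀ (one_lt_base_mul hN ha)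
  obtain ⟨K, hK⟩ := exists_pow_mul_lt_one (by positivity) hv1
    (((2 * N + 1 : ℕ) : ℝ) * bParam N a)⁻¹
  have key := not_countable_of_digits (P := fun x =>
    ¬ DifferentiableWithinAt ℝ (F N a) (Icc 0 1) x) hN K false fun x k hk hdig => by
      rw [hk.differentiableWithinAt_iff hN ha]
      have hinv : Tendsto (fun n => |cellSlope N a n (k n)|⁻¹) atTop (𝓝 0) := by
        refine tendsto_zero_of_blocks (fun _ => by positivity) (by positivity) (by positivity)
          hv1.le (fun n => ?_) (fun n hn => ?_) hK
        · rw [hk.abs_cellSlope_succ hN ha, mul_inv]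
          gcongr
          split_ifs
          exacts [hba.le, le_rfl]
        · rw [hk.abs_cellSlope_succ hN ha, hdig n hn, mul_inv]
          simp
      intro h
      have h1 := h.abs.mul hinv
      rw [abs_zero, zero_mul] at h1
      refine zero_ne_one (tendsto_nhds_unique h1 (tendsto_const_nhds.congr fun n => ?_))
      rw [mul_inv_cancel₀ (abs_ne_zero.2 (cellSlope_ne_zero hN ha _ _))]
  convert key using 4 with x
  exact and_congr_right fun hx => not_congr (differentiableAt_iff_within hx)

/-! ### Averages over the cells of a level -/

open Finset in
theorem sum_range_mul_div_mod {M : Type*} [AddCommMonoid M] {q : ℕ} (hq : 0 < q) (m : ℕ)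
    (G : ℕ → ℕ → M) : ∑ k ∈ range (m * q), G (k / q) (k % q) =
      ∑ k ∈ range m, ∑ j ∈ range q, G k j := by
  induction m with
  | zero => simp
  | succ m ih =>
    rw [Nat.succ_mul, sum_range_add, ih, sum_range_succ]
    congr 1
    refine sum_congr rfl fun j hj => ?_
    have hj := mem_range.1 hj
    rw [mul_comm, Nat.mul_add_div hq, Nat.div_eq_of_lt hj, Nat.mul_add_mod, Nat.mod_eq_of_lt hj,
      add_zero]

open Finset in
theorem sum_digits (N : ℕ) (u v : ℝ) :
    ∑ j ∈ range (2 * N + 1), (if Even j then u else v) = (N + 1) * u + N * v := by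
  induction N with
  | zero => simp
  | succ N ih =>
    rw [show 2 * (N + 1) + 1 = 2 * N + 1 + 1 + 1 by ring, sum_range_succ, sum_range_succ, ih,
      if_neg (by simp), if_pos (by simp [Nat.even_add_one])]
    push_cast
    ring

/-- The integral over `[0, 1)` of a function that is constant on each of `Q` equal cells. -/
theorem lintegral_floor {Q : ℕ} (hQ : 0 < Q) (g : ℕ → ENNReal) :
    ∫⁻ x in Ico (0 : ℝ) 1, g ⌊x * (Q : ℝ)⌋₊ = (∑ k ∈ Finset.range Q, g k) / Q := by
  have hQ0 : (0 : ℝ) < Q := by exact_mod_cast hQ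
  have key : ∀ m : ℕ, ∫⁻ x in Ico (0 : ℝ) (m / Q), g ⌊x * (Q : ℝ)⌋₊ =
      (∑ k ∈ Finset.range m, g k) / Q := by
    intro m
    induction m with
    | zero => simp
    | succ m ih =>
      have hle : (m : ℝ) / Q ≤ (m + 1 : ℕ) / Q := by gcongr; simp
      rw [← Ico_union_Ico_eq_Ico (by positivity : (0 : ℝ) ≤ m / Q) hle,
        lintegral_union measurableSet_Ico
          (Ico_disjoint_Ico_same), ih, Finset.sum_range_succ, ENNReal.add_div]
      congr 1
      have hconst : ∀ x ∈ Ico ((m : ℝ) / Q) ((m + 1 : ℕ) / Q), g ⌊x * (Q : ℝ)⌋₊ = g m := by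
        intro x hx
        have h1 := (div_le_iff₀ hQ0).1 hx.1
        have h2 := (lt_div_iff₀ hQ0).1 hx.2
        push_cast at h2
        rw [(Nat.floor_eq_iff (by linarith [m.cast_nonneg (α := ℝ)])).2 ⟨h1, h2⟩]
      rw [setLIntegral_congr_fun measurableSet_Ico hconst, setLIntegral_const, Real.volume_Ico,
        ← sub_div, Nat.cast_succ, add_sub_cancel_left, one_div, ENNReal.ofReal_inv_of_pos hQ0,
        ENNReal.ofReal_natCast, div_eq_mul_inv]
  have h := key Q
  rwa [div_self hQ0.ne'] at h

/-- The index of the half-open cell `[k / q ^ n, (k + 1) / q ^ n)`, with `q = 2N+1`, that contains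
`x`; meant for `x ∈ [0, 1)`. -/
noncomputable def cellIndex (N n : ℕ) (x : ℝ) : ℕ := ⌊x * ((2 * N + 1 : ℕ) : ℝ) ^ n⌋₊

theorem measurable_cellIndex (N n : ℕ) : Measurable (cellIndex N n) :=
  Nat.measurable_floor.comp (measurable_id.mul_const _)

theorem lintegral_cellIndex (N n : ℕ) (g : ℕ → ℝ) (hg : ∀ k, 0 ≤ g k) :
    ∫⁻ x in Ico (0 : ℝ) 1, ENNReal.ofReal (g (cellIndex N n x)) =
      ENNReal.ofReal ((∑ k ∈ Finset.range ((2 * N + 1) ^ n), g k) /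
        ((2 * N + 1 : ℕ) : ℝ) ^ n) := by
  have hQ : 0 < (2 * N + 1) ^ n := by positivity
  have h := lintegral_floor hQ (fun k => ENNReal.ofReal (g k))
  rw [← ENNReal.ofReal_sum_of_nonneg fun k _ => hg k] at h
  rw [ENNReal.ofReal_div_of_pos (by positivity)]
  simp only [Nat.cast_pow] at h
  rw [← ENNReal.ofReal_natCast, ← ENNReal.ofReal_pow (by positivity)] at h
  exact h

theorem ae_restrict_Icc_of_Ico {P : ℝ → Prop}
    (h : ∀ᵐ x ∂(volume.restrict (Ico (0 : ℝ) 1)), P x) :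
    ∀ᵐ x ∂(volume.restrict (Icc (0 : ℝ) 1)), P x := by
  rwa [← Measure.restrict_congr_set (Ico_ae_eq_Icc (μ := volume) (a := (0 : ℝ)) (b := 1))]

/-! ### Differentiability almost everywhere below the threshold -/

/-- The derivative of `n * u ^ ε + m * v ^ ε` at `ε = 0` is `n * log u + m * log v`. -/
theorem exists_rpow_average_lt (n m : ℕ) {u v : ℝ} (hu : 0 < u) (hv : 0 < v)
    (h : (n : ℝ) * Real.log u + m * Real.log v < 0) :
    ∃ ε : ℝ, 0 < ε ∧ (n : ℝ) * u ^ ε + m * v ^ ε < n + m := by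
  have hd : HasDerivAt (fun ε : ℝ => (n : ℝ) * u ^ ε + m * v ^ ε)
      ((n : ℝ) * Real.log u + m * Real.log v) 0 := by
    have h1 := (Real.hasStrictDerivAt_const_rpow hu 0).hasDerivAt.const_mul (n : ℝ)
    have h2 := (Real.hasStrictDerivAt_const_rpow hv 0).hasDerivAt.const_mul (m : ℝ)
    have h3 := h1.add h2
    simp only [Real.rpow_zero, one_mul] at h3
    exact h3
  have ht := (hasDerivAt_iff_tendsto_slope.1 hd).eventually_lt_const h
  have ht' := ht.filter_mono (nhdsWithin_mono (0 : ℝ)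
    (fun x (hx : x ∈ Ioi 0) => (mem_Ioi.1 hx).ne'))
  obtain ⟨ε, h1, h2⟩ := (ht'.and self_mem_nhdsWithin).exists
  have hε : (0 : ℝ) < ε := h2
  refine ⟨ε, hε, ?_⟩
  rw [slope_def_field, sub_zero, div_neg_iff] at h1
  rcases h1 with h1 | h1
  · linarith
  · simpa using h1.1

open Finset in
theorem sum_cellSlope_rpow (N : ℕ) (a ε : ℝ) (n : ℕ) :
    ∑ k ∈ range ((2 * N + 1) ^ n), |cellSlope N a n k| ^ ε =
      (∑ j ∈ range (2 * N + 1), |digitSlope N a j| ^ ε) ^ n := by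
  induction n with
  | zero => simp [cellSlope]
  | succ n ih =>
    simp only [cellSlope, abs_mul]
    rw [pow_succ, sum_range_mul_div_mod (by omega) _
      (fun k j => (|cellSlope N a n k| * |digitSlope N a j|) ^ ε), pow_succ, ← ih, sum_mul_sum]
    refine sum_congr rfl fun k _ => sum_congr rfl fun j _ => ?_
    rw [Real.mul_rpow (abs_nonneg _) (abs_nonneg _)]

/-- If the mean of `log |digitSlope|` is negative, some power of the slopes has means over the
levels that decay geometrically; hence these powers are summable at almost every point. -/
theorem ae_differentiableWithinAt (hN : 1 ≤ N) (ha : a ∈ Ioo (aMin N) 1) (hs : a < aTilde N) :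
    ∀ᵐ x ∂(volume.restrict (Icc (0 : ℝ) 1)), DifferentiableWithinAt ℝ (F N a) (Icc 0 1) x := by
  obtain ⟨hb0, hba⟩ := bParam_mem hN ha
  have ha0 := hb0.trans hba
  set q : ℝ := ((2 * N + 1 : ℕ) : ℝ) with hq
  have hq0 : 0 < q := by positivity
  have hmean : ((N + 1 : ℕ) : ℝ) * Real.log (q * a) + N * Real.log (q * bParam N a) < 0 := by
    have := (aTilde_le_iff hN ha).not.1 (not_le.2 hs)
    push_cast
    linarith
  obtain ⟨ε, hε, hlt⟩ := exists_rpow_average_lt (N + 1) N (by positivity) (by positivity) hmean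
  set R : ℝ := ∑ j ∈ Finset.range (2 * N + 1), |digitSlope N a j| ^ ε with hR
  have hR0 : 0 ≤ R := Finset.sum_nonneg fun _ _ => by positivity
  have hRq : R / q < 1 := by
    have : R = ((N : ℝ) + 1) * (q * a) ^ ε + N * (q * bParam N a) ^ ε := by
      rw [hR, ← sum_digits]
      refine Finset.sum_congr rfl fun j _ => ?_
      rw [digitSlope_abs hN ha]
      split_ifs <;> rfl
    have hqe : q = (N + 1 : ℕ) + N := by rw [hq]; push_cast; ring
    rw [← hqe, Nat.cast_succ] at hlt
    rwa [div_lt_one hq0, this]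
  have hint : ∫⁻ x in Ico (0 : ℝ) 1, ∑' n, ENNReal.ofReal
      (|cellSlope N a n (cellIndex N n x)| ^ ε) ≠ ⊤ := by
    rw [lintegral_tsum fun n => ?_]
    · simp only [fun n => lintegral_cellIndex N n (fun k => |cellSlope N a n k| ^ ε)
        (fun k => by positivity), sum_cellSlope_rpow, ← div_pow]
      rw [← ENNReal.ofReal_tsum_of_nonneg (fun n => by positivity)
        (summable_geometric_of_lt_one (by positivity) hRq)]
      exact ENNReal.ofReal_ne_top
    · exact ((Measurable.of_discrete (f := fun k => ENNReal.ofReal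
        (|cellSlope N a n k| ^ ε))).comp (measurable_cellIndex N n)).aemeasurable
  refine ae_restrict_Icc_of_Ico ?_
  have hae := ae_lt_top' (AEMeasurable.tsum fun n =>
    ((Measurable.of_discrete (f := fun k => ENNReal.ofReal
        (|cellSlope N a n k| ^ ε))).comp (measurable_cellIndex N n)).aemeasurable) hint
  filter_upwards [hae, ae_restrict_mem measurableSet_Ico] with x hx hx01
  rw [(isAddress_floor hx01).differentiableWithinAt_iff hN ha,
    tendsto_zero_iff_abs_tendsto_zero]
  have h1 := (ENNReal.tendsto_toReal ENNReal.zero_ne_top).comp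
    (ENNReal.tendsto_atTop_zero_of_tsum_ne_top hx.ne)
  have h2 : Tendsto (fun n => |cellSlope N a n (cellIndex N n x)| ^ ε) atTop (𝓝 0) := by
    refine h1.congr fun n => ?_
    exact ENNReal.toReal_ofReal (by positivity)
  have h3 := h2.rpow_const (p := ε⁻¹) (Or.inr (by positivity))
  rw [Real.zero_rpow (by positivity)] at h3
  refine h3.congr fun n => ?_
  rw [← Real.rpow_mul (abs_nonneg _), mul_inv_cancel₀ hε.ne', Real.rpow_one]
  rfl

/-! ### Nondifferentiability almost everywhere from the threshold on -/

/-- The walk `log |cellSlope|` on the tree of cells, stopped when it first reaches `M`. -/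
noncomputable def stoppedLog (N : ℕ) (a M : ℝ) : ℕ → ℕ → ℝ
  | 0, _ => 0
  | n + 1, k => stoppedLog N a M n (k / (2 * N + 1)) +
      if M ≤ stoppedLog N a M n (k / (2 * N + 1)) then 0
      else Real.log |digitSlope N a (k % (2 * N + 1))|

theorem log_digitSlope_le (hN : 1 ≤ N) (ha : a ∈ Ioo (aMin N) 1) (j : ℕ) :
    Real.log |digitSlope N a j| ≤ Real.log (((2 * N + 1 : ℕ) : ℝ) * a) := by
  obtain ⟨hb0, hba⟩ := bParam_mem hN ha
  refine Real.log_le_log (abs_pos.2 (digitSlope_ne_zero hN ha j)) ?_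
  rw [digitSlope_abs hN ha]
  gcongr
  split_ifs
  exacts [le_rfl, hba.le]

theorem stoppedLog_le (hN : 1 ≤ N) (ha : a ∈ Ioo (aMin N) 1) {M : ℝ} (hM : 0 ≤ M) (n k : ℕ) :
    stoppedLog N a M n k ≤ M + Real.log (((2 * N + 1 : ℕ) : ℝ) * a) := by
  have hB : 0 ≤ Real.log (((2 * N + 1 : ℕ) : ℝ) * a) :=
    Real.log_nonneg (one_lt_base_mul hN ha).le
  induction n generalizing k with
  | zero => simp only [stoppedLog]; linarith
  | succ n ih =>
    rw [stoppedLog]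
    split_ifs with h
    · rw [add_zero]; exact ih _
    · linarith [log_digitSlope_le hN ha (k % (2 * N + 1))]

open Finset in
/-- The mean of the stopped walk over a level is nonnegative if the steps have nonnegative mean. -/
theorem sum_stoppedLog_nonneg (hN : 1 ≤ N) (ha : a ∈ Ioo (aMin N) 1) (hs : aTilde N ≤ a)
    (M : ℝ) (n : ℕ) : 0 ≤ ∑ k ∈ range ((2 * N + 1) ^ n), stoppedLog N a M n k := by
  induction n with
  | zero => simp [stoppedLog]
  | succ n ih =>
    have hstep : 0 ≤ ∑ j ∈ range (2 * N + 1), Real.log |digitSlope N a j| := by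
      have := (aTilde_le_iff hN ha).1 hs
      rw [← sum_digits] at this
      convert this using 3 with j
      rw [digitSlope_abs hN ha]
      split_ifs <;> rfl
    simp only [stoppedLog]
    rw [pow_succ, sum_range_mul_div_mod (by omega) _ (fun k j => stoppedLog N a M n k +
      if M ≤ stoppedLog N a M n k then 0 else Real.log |digitSlope N a j|)]
    calc (0 : ℝ) ≤ ∑ k ∈ range ((2 * N + 1) ^ n), (2 * N + 1 : ℕ) * stoppedLog N a M n k := by
          rw [← mul_sum]; positivity
      _ ≤ _ := by
          refine sum_le_sum fun k _ => ?_
          rw [sum_add_distrib, sum_const, card_range, nsmul_eq_mul]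
          refine le_add_of_nonneg_right ?_
          split_ifs
          · simp
          · exact hstep

/-- By Fatou's lemma a walk that is bounded above and has nonnegative mean tends to `-∞` almost
nowhere. -/
theorem ae_not_tendsto_stoppedLog (hN : 1 ≤ N) (ha : a ∈ Ioo (aMin N) 1) (hs : aTilde N ≤ a)
    {M : ℝ} (hM : 0 ≤ M) : ∀ᵐ x ∂(volume.restrict (Ico (0 : ℝ) 1)),
      ¬ Tendsto (fun n => stoppedLog N a M n (cellIndex N n x)) atTop atBot := by
  set C : ℝ := M + Real.log (((2 * N + 1 : ℕ) : ℝ) * a) with hC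
  set g : ℕ → ℝ → ENNReal := fun n x =>
    ENNReal.ofReal (C - stoppedLog N a M n (cellIndex N n x)) with hg
  have hmeas : ∀ n, Measurable (g n) := fun n =>
    (Measurable.of_discrete (f := fun k => ENNReal.ofReal (C - stoppedLog N a M n k))).comp
      (measurable_cellIndex N n)
  have hint : ∀ n, ∫⁻ x in Ico (0 : ℝ) 1, g n x ≤ ENNReal.ofReal C := by
    intro n
    simp only [hg]
    rw [lintegral_cellIndex N n (fun k => C - stoppedLog N a M n k)
      (fun k => sub_nonneg.2 (stoppedLog_le hN ha hM n k))]
    refine ENNReal.ofReal_le_ofReal ?_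
    rw [Finset.sum_sub_distrib, Finset.sum_const, Finset.card_range, nsmul_eq_mul, Nat.cast_pow,
      div_le_iff₀ (by positivity), mul_comm C]
    linarith [sum_stoppedLog_nonneg hN ha hs M n]
  have hfatou : ∫⁻ x in Ico (0 : ℝ) 1, liminf (fun n => g n x) atTop ≠ ⊤ := by
    refine ne_top_of_le_ne_top (ENNReal.ofReal_ne_top (r := C)) ?_
    refine (lintegral_liminf_le hmeas).trans ?_
    exact liminf_le_of_frequently_le' (Frequently.of_forall hint)
  filter_upwards [ae_lt_top (Measurable.liminf hmeas) hfatou] with x hx hlim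
  refine hx.ne (Tendsto.liminf_eq ?_)
  exact ENNReal.tendsto_ofReal_atTop.comp
    (tendsto_const_nhds.add_atTop (tendsto_neg_atBot_atTop.comp hlim))

/-- Below `M` the stopped walk is the logarithm of the slope. -/
theorem IsAddress.stoppedLog_eq (hN : 1 ≤ N) (ha : a ∈ Ioo (aMin N) 1) {x : ℝ} {k : ℕ → ℕ}
    (hk : IsAddress N x k) {M : ℝ} (hM : ∀ n, Real.log |cellSlope N a n (k n)| < M) (n : ℕ) :
    stoppedLog N a M n (k n) = Real.log |cellSlope N a n (k n)| := by
  induction n with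
  | zero => simp [stoppedLog, cellSlope]
  | succ n ih =>
    rw [stoppedLog, hk.div, ih, if_neg (not_le.2 (hM n)), hk.cellSlope_succ, abs_mul,
      Real.log_mul (abs_ne_zero.2 (cellSlope_ne_zero hN ha _ _))
        (abs_ne_zero.2 (digitSlope_ne_zero hN ha _))]

theorem ae_not_differentiableWithinAt (hN : 1 ≤ N) (ha : a ∈ Ioo (aMin N) 1)
    (hs : aTilde N ≤ a) : ∀ᵐ x ∂(volume.restrict (Icc (0 : ℝ) 1)),
      ¬ DifferentiableWithinAt ℝ (F N a) (Icc 0 1) x := by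
  refine ae_restrict_Icc_of_Ico ?_
  have hall : ∀ᵐ x ∂(volume.restrict (Ico (0 : ℝ) 1)), ∀ M : ℕ,
      ¬ Tendsto (fun n => stoppedLog N a M n (cellIndex N n x)) atTop atBot :=
    ae_all_iff.2 fun M => ae_not_tendsto_stoppedLog hN ha hs M.cast_nonneg
  filter_upwards [hall, ae_restrict_mem measurableSet_Ico] with x hx hx01
  have hk := isAddress_floor (N := N) hx01
  rw [hk.differentiableWithinAt_iff hN ha]
  intro hlim
  -- The logarithms tend to `-∞`, so they stay below some `M` and the walk is never stopped.
  have hlog : Tendsto (fun n => Real.log |cellSlope N a n (cellIndex N n x)|) atTop atBot := by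
    simp only [Real.log_abs]
    exact Real.tendsto_log_nhdsNE_zero.comp (tendsto_nhdsWithin_iff.2
      ⟨hlim, Eventually.of_forall fun n => cellSlope_ne_zero hN ha _ _⟩)
  obtain ⟨B, hB⟩ := hlim.abs.bddAbove_range
  obtain ⟨M, hM⟩ := exists_nat_gt (Real.log B)
  refine hx M (hlog.congr fun n => (hk.stoppedLog_eq hN ha (fun m => ?_) n).symm)
  refine lt_of_le_of_lt (Real.log_le_log (abs_pos.2 (cellSlope_ne_zero hN ha _ _)) ?_) hM
  exact hB ⟨m, rfl⟩

end OkamotoAllaart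

theorem mainTheorem1 (N : ℕ) (hN : 1 ≤ N) (a : ℝ) (ha : aMin N < a) (ha1 : a < 1) :
    (aStar N ≤ a →
      ∀ x ∈ Icc (0 : ℝ) 1, ¬ DifferentiableWithinAt ℝ (F N a) (Icc 0 1) x) ∧
    (aTilde N ≤ a → a < aStar N →
      (∀ᵐ x ∂(volume.restrict (Icc (0 : ℝ) 1)),
        ¬ DifferentiableWithinAt ℝ (F N a) (Icc 0 1) x) ∧
      ¬ {x ∈ Ioo (0 : ℝ) 1 | DifferentiableAt ℝ (F N a) x}.Countable) ∧
    (a < aTilde N →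
      (∀ᵐ x ∂(volume.restrict (Icc (0 : ℝ) 1)),
        DifferentiableWithinAt ℝ (F N a) (Icc 0 1) x) ∧
      ¬ {x ∈ Ioo (0 : ℝ) 1 | ¬ DifferentiableAt ℝ (F N a) x}.Countable) ∧
    (∀ x ∈ Ioo (0 : ℝ) 1, ∀ L : ℝ, HasDerivAt (F N a) L x → L = 0) := by
  have hmem : a ∈ Ioo (aMin N) 1 := ⟨ha, ha1⟩
  refine ⟨fun h x hx => not_differentiableWithinAt_of_aStar_le hN hmem h hx,
    fun h1 h2 => ⟨ae_not_differentiableWithinAt hN hmem h1,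
      not_countable_differentiableAt hN hmem h2⟩,
    fun h => ⟨ae_differentiableWithinAt hN hmem h,
      not_countable_not_differentiableAt hN hmem⟩,
    fun x hx L hL => ?_⟩
  obtain ⟨k, hk⟩ := exists_isAddress (N := N) (Ioo_subset_Icc_self hx)
  exact hk.deriv_eq_zero hN hmem hL.hasDerivWithinAt
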